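/- Let $(X,d)$ be a complete separable metric space with its Borel $\sigma$-algebra, and let $m=(m_x)_{x\in X}$ be a random walk on $X$: each $m_x$ is a Borel probability measure with $\int_X d(z,y)\,dm_x(y)<\infty$ for all $z\in X$, and $x\mapsto m_x(A)$ is measurable for every Borel set $A$. Let $\nu$ be a finite nonzero Borel measure on $X$ that is reversible for $m$, i.e. $dm_x(y)\,d\nu(x)=dm_y(x)\,d\nu(y)$, and such that $\frac{1}{\nu(X)}\nu$ is ergodic, i.e. every Borel set $B$ with $m_x(B)=1$ for all $x\in B$ satisfies $\nu(B)=0$ or $\nu(B)=\nu(X)$. For $u\in L^2(X,\nu)$ put $$\mathcal F_m(u)=TV_m(u)=\frac12\int_X\int_X|u(y)-u(x)|\,dm_x(y)\,d\nu(x)\in[0,+\infty],$$ and let $\Delta_1^m$ be the multivalued operator in $L^2(X,\nu)$ defined by $\xi\in\Delta_1^m v$ if and only if $-\xi\in\partial\mathcal F_m(v)$, where $\partial\mathcal F_m$ is the subdifferential. Let $\lambda>0$ and $f\in L^2(X,\nu)$. A strong solution on $(0,\tau)$ of the Cauchy problem $$v_t\in\Delta_1^m v-\lambda(v-f),\qquad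 v(0)=v_0,$$ is a function $v\in C([0,\tau];L^2(X,\nu))\cap W^{1,1}_{\mathrm{loc}}(0,\tau;L^2(X,\nu))$ with $v(0)=v_0$ and $\lambda(v(t)-f)+v_t(t)\in\Delta_1^m(v(t))$ for almost every $t\in(0,\tau)$. **Theorem.** 1. There is a unique minimizer $u_\lambda$ of $u\mapsto TV_m(u)+\frac\lambda2\int_X|u-f|^2\,d\nu$ over $L^2(X,\nu)$. 2. There is a unique family of maps $T_\lambda(t):L^2(X,\nu)\to L^2(X,\nu)$, $t\ge0$, such that for every $v_0\in L^2(X,\nu)$ and every $\tau>0$ the function $t\mapsto T_\lambda(t)v_0$ is a strong solution on $(0,\tau)$ of the Cauchy problem with initial datum $v_0$. This family is a semigroup: $T_\lambda(0)=\mathrm{Id}$ and $T_\lambda(s+t)=T_\lambda(s)T_\lambda(t)$ for all $s,t\ge 0$. 3. For every $v_0\in L^2(X,\nu)$, $$\|T_\lambda(t)v_0-u_\lambda\|_2\le\|v_0-u_\lambda\|_2\,e^{-\lambda t}\qquad\text{for all }t\ge0.$$ -/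

import Mathlib

open MeasureTheory ProbabilityTheory Set
open scoped NNReal ENNReal

namespace MRW

variable {X : Type*} [MeasurableSpace X]

/-- A probability measure `μ` which is invariant for the random walk `m` is ergodic if every Borel
set `B` with `m x B = 1` for all `x ∈ B` satisfies `μ B = 0` or `μ B = 1`. -/
structure IsErgodic (m : Kernel X X) (μ : Measure X) : Prop where
  isProbabilityMeasure : IsProbabilityMeasure μ
  invariant : Kernel.Invariant m μ
  zero_or_one : ∀ B : Set X, MeasurableSet B → (∀ x ∈ B, m x B = 1) → μ B = 0 ∨ μ B = 1

/-- The total variation `(1/2) ∫∫ |u y - u x| dm_x(y) dν(x)`, as an extended nonnegative number: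
it is finite exactly when `u` (measurable) belongs to `BV_m`. -/
noncomputable def totalVariation (m : Kernel X X) (ν : Measure X) (u : X → ℝ) : ℝ≥0∞ :=
  2⁻¹ * ∫⁻ x, ∫⁻ y, ENNReal.ofReal |u y - u x| ∂(m x) ∂ν

/-- The functional on `L²(X, ν)` equal to the total variation on `L² ∩ BV_m` and to `+∞` on the
rest of `L²`. -/
noncomputable def tvFunctional (m : Kernel X X) (ν : Measure X) (u : Lp ℝ 2 ν) : EReal :=
  (totalVariation m ν u : EReal)

/-- The subdifferential at `u` of a (proper) functional `Φ` with values in `]-∞, +∞]`. -/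
def subdifferential {H : Type*} [NormedAddCommGroup H] [InnerProductSpace ℝ H]
    (Φ : H → EReal) (u : H) : Set H :=
  {ξ | ∀ w : H, Φ u + ((inner ℝ ξ (w - u) : ℝ) : EReal) ≤ Φ w}

/-- The (multivalued) 1-Laplacian `Δ₁^m v`: the set of all `ξ ∈ L²` such that `-ξ` belongs to the
subdifferential at `v` of the total variation functional. -/
def oneLaplacian (m : Kernel X X) (ν : Measure X) (v : Lp ℝ 2 ν) : Set (Lp ℝ 2 ν) :=
  {ξ | -ξ ∈ subdifferential (tvFunctional m ν) v}

/-- The energy of the `m`-ROF model, `TV_m(u) + (lam/2) ‖u - f‖²`. -/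
noncomputable def rofEnergy (m : Kernel X X) (ν : Measure X) (lam : ℝ) (f u : Lp ℝ 2 ν) : EReal :=
  tvFunctional m ν u + ((lam / 2 * ‖u - f‖ ^ 2 : ℝ) : EReal)

/-- `u` minimizes the `m`-ROF energy over `L²(X, ν)`. -/
def IsROFMinimizer (m : Kernel X X) (ν : Measure X) (lam : ℝ) (f u : Lp ℝ 2 ν) : Prop :=
  ∀ w : Lp ℝ 2 ν, rofEnergy m ν lam f u ≤ rofEnergy m ν lam f w

/-- `v` belongs to `C([0, τ]; L²) ∩ W^{1,1}_loc(0, τ; L²)` (it is locally the integral of a locally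
integrable function `v'`), `v 0 = v₀`, and
`lam (v t - f) + v' t ∈ Δ₁^m (v t)` for almost every `t ∈ (0, τ)`. -/
structure IsStrongSolution (m : Kernel X X) (ν : Measure X) (lam : ℝ) (f v₀ : Lp ℝ 2 ν)
    (τ : ℝ) (v : ℝ → Lp ℝ 2 ν) : Prop where
  continuousOn : ContinuousOn v (Icc 0 τ)
  initial : v 0 = v₀
  exists_deriv : ∃ v' : ℝ → Lp ℝ 2 ν,
    LocallyIntegrableOn v' (Ioo 0 τ) ∧
    (∀ s ∈ Ioo 0 τ, ∀ t ∈ Ioo 0 τ, v t - v s = ∫ r in s..t, v' r) ∧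
    ∀ᵐ t, t ∈ Ioo 0 τ → lam • (v t - f) + v' t ∈ oneLaplacian m ν (v t)

/-- `T t v₀` is the value at time `t` of a strong solution, on every time interval `(0, τ)`, of
`v_t ∈ Δ₁^m v - lam (v - f)`, `v 0 = v₀`, for every initial datum `v₀ ∈ L²(X, ν)`. -/
def IsSolutionFamily (m : Kernel X X) (ν : Measure X) (lam : ℝ) (f : Lp ℝ 2 ν)
    (T : ℝ≥0 → Lp ℝ 2 ν → Lp ℝ 2 ν) : Prop :=
  ∀ v₀ : Lp ℝ 2 ν, ∀ τ : ℝ, 0 < τ →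
    IsStrongSolution m ν lam f v₀ τ (fun t => T t.toNNReal v₀)

end MRW

/-! Reversibility makes `ν` invariant, so both marginals of `ν ⊗ₘ m` are `ν` and the nonlocal
gradient `u y - u x` is a bounded linear map from `L²(ν)` to `L¹(ν ⊗ₘ m)`. Hence the total variation
is half the norm of a bounded operator: finite on all of `L²`, convex, and globally Lipschitz
(`exists_isLipschitzConvex_tvFunctional`). The rest is the gradient flow of `Φ + lam / 2 * ‖· - f‖ ^
2` in a Hilbert space, with `Φ` convex and Lipschitz.

The Lipschitz constant bounds every subgradient, so velocities are bounded wherever the curve is. A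
strong solution, a priori only locally absolutely continuous inside the interval, is therefore
Lipschitz up to the endpoints (`IsStrongSolution.isFlowOn`). Monotonicity of the subdifferential
together with the quadratic term makes velocities strongly monotone with constant `lam`; an
integrating factor turns this into an exponential contraction (`IsFlowOn.norm_sub_le`), hence
uniqueness.

Existence is by implicit Euler (`IsLipschitzConvex.exists_isFlowOn`). The same monotonicity makes
the Euler curves Cauchy. Their velocities are bounded and converge only weakly, but the subgradient
inequality at a fixed competitor is affine in the velocity and so survives the limit.

The semigroup law is uniqueness applied to a time-shifted solution. The ROF minimizer is a
stationary solution, so the decay estimate is the contraction against a constant curve. -/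

namespace MRW

open Filter Topology

/-! ### Subgradients, minimizers and the implicit Euler step. -/

section Subgradient

variable {H : Type*} [NormedAddCommGroup H] [InnerProductSpace ℝ H]

/-- `ξ` is a subgradient at `x` of the real-valued functional `Φ`. -/
def IsSubgradient (Φ : H → ℝ) (x ξ : H) : Prop :=
  ∀ w : H, Φ x + inner ℝ ξ (w - x) ≤ Φ w

/-- A nonnegative convex functional satisfying a Lipschitz estimate with constant `L`. -/
structure IsLipschitzConvex (Φ : H → ℝ) (L : ℝ) : Prop where
  convexOn : ConvexOn ℝ univ Φ
  const_nonneg : 0 ≤ L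
  nonneg : ∀ x, 0 ≤ Φ x
  sub_le : ∀ x y, Φ x - Φ y ≤ L * ‖x - y‖

variable {Φ : H → ℝ} {L : ℝ}

theorem IsLipschitzConvex.continuous (h : IsLipschitzConvex Φ L) : Continuous Φ := by
  have : LipschitzWith L.toNNReal Φ := by
    refine LipschitzWith.of_dist_le_mul fun x y => ?_
    rw [Real.dist_eq, dist_eq_norm, abs_le]
    have h1 := h.sub_le x y
    have h2 := h.sub_le y x
    rw [norm_sub_rev] at h2
    have h3 : L * ‖x - y‖ ≤ L.toNNReal * ‖x - y‖ := by
      gcongr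
      exact Real.le_coe_toNNReal L
    constructor <;> linarith
  exact this.continuous

theorem IsSubgradient.inner_sub_nonneg {x y ξ η : H} (hx : IsSubgradient Φ x ξ)
    (hy : IsSubgradient Φ y η) : 0 ≤ inner ℝ (ξ - η) (x - y) := by
  have h1 := hx y
  have h2 := hy x
  rw [← neg_sub x y, inner_neg_right] at h1
  rw [inner_sub_left]
  linarith

/-- Testing with the competitor `x + ξ` gives `‖ξ‖ ^ 2 ≤ L * ‖ξ‖`. -/
theorem IsSubgradient.norm_le (h : IsLipschitzConvex Φ L) {x ξ : H}
    (hx : IsSubgradient Φ x ξ) : ‖ξ‖ ≤ L := by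
  have h1 := hx (x + ξ)
  have h2 := h.sub_le (x + ξ) x
  rw [add_sub_cancel_left, real_inner_self_eq_norm_sq] at h1
  rw [add_sub_cancel_left] at h2
  by_contra! hlt
  nlinarith [h.const_nonneg]

/-- Compare `p` with `p + t • (w - p)`, use convexity, divide by `t` and let `t → 0⁺`. -/
theorem isSubgradient_of_forall_le (hΦ : ConvexOn ℝ univ Φ) {c : ℝ} {p z : H}
    (hp : ∀ w, Φ p + c / 2 * ‖p - z‖ ^ 2 ≤ Φ w + c / 2 * ‖w - z‖ ^ 2) :
    IsSubgradient Φ p (c • (z - p)) := by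
  intro w
  have key : ∀ t ∈ Ioo (0 : ℝ) 1,
      Φ p + inner ℝ (c • (z - p)) (w - p) - c / 2 * t * ‖w - p‖ ^ 2 ≤ Φ w := by
    intro t ht
    have h1 := hp (p + t • (w - p))
    have h2 : Φ (p + t • (w - p)) ≤ (1 - t) * Φ p + t * Φ w := by
      have := hΦ.2 (mem_univ p) (mem_univ w) (sub_nonneg.2 ht.2.le) ht.1.le (by ring)
      rwa [show (1 - t) • p + t • w = p + t • (w - p) by module] at this
    have h3 : ‖p + t • (w - p) - z‖ ^ 2
        = ‖p - z‖ ^ 2 - 2 * t * inner ℝ (z - p) (w - p) + t ^ 2 * ‖w - p‖ ^ 2 := by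
      rw [show p + t • (w - p) - z = (p - z) + t • (w - p) by module, norm_add_sq_real,
        inner_smul_right, norm_smul, mul_pow, Real.norm_eq_abs, sq_abs, ← neg_sub z p,
        inner_neg_left, norm_neg]
      ring
    rw [h3] at h1
    rw [inner_smul_left]
    simp only [conj_trivial]
    have ht0 := ht.1
    refine le_of_mul_le_mul_left ?_ ht0
    nlinarith
  have hlim : Tendsto (fun t : ℝ =>
      Φ p + inner ℝ (c • (z - p)) (w - p) - c / 2 * t * ‖w - p‖ ^ 2) (𝓝[>] 0)
      (𝓝 (Φ p + inner ℝ (c • (z - p)) (w - p) - c / 2 * 0 * ‖w - p‖ ^ 2)) := by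
    apply Tendsto.mono_left _ nhdsWithin_le_nhds
    exact Continuous.tendsto (by fun_prop) 0
  have := le_of_tendsto hlim
    (by filter_upwards [Ioo_mem_nhdsGT (zero_lt_one' ℝ)] with t ht using key t ht)
  simpa using this

/-- The extra term `c / 2 * ‖w - p‖ ^ 2` is the strong convexity gap, which yields uniqueness of the
minimizer. -/
theorem IsSubgradient.add_sq_le {c : ℝ} {p z : H}
    (hp : IsSubgradient Φ p (c • (z - p))) (w : H) :
    Φ p + c / 2 * ‖p - z‖ ^ 2 + c / 2 * ‖w - p‖ ^ 2 ≤ Φ w + c / 2 * ‖w - z‖ ^ 2 := by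
  have h := hp w
  have h3 : ‖w - z‖ ^ 2 = ‖w - p‖ ^ 2 - 2 * inner ℝ (z - p) (w - p) + ‖p - z‖ ^ 2 := by
    rw [show w - z = (w - p) - (z - p) by abel, norm_sub_sq_real, norm_sub_rev z p,
      real_inner_comm]
  rw [inner_smul_left] at h
  simp only [conj_trivial] at h
  rw [h3]
  linarith

theorem IsLipschitzConvex.exists_minimizer [CompleteSpace H] (h : IsLipschitzConvex Φ L)
    {c : ℝ} (hc : 0 < c) (z : H) :
    ∃ p, ∀ w, Φ p + c / 2 * ‖p - z‖ ^ 2 ≤ Φ w + c / 2 * ‖w - z‖ ^ 2 := by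
  set J : H → ℝ := fun w => Φ w + c / 2 * ‖w - z‖ ^ 2 with hJ
  have hJc : Continuous J := by
    have := h.continuous
    fun_prop
  have hJ0 : ∀ w, 0 ≤ J w := fun w => add_nonneg (h.nonneg w) (by positivity)
  have hbdd : BddBelow (range J) := ⟨0, by rintro _ ⟨w, rfl⟩; exact hJ0 w⟩
  set I : ℝ := ⨅ w, J w with hI
  have hIle : ∀ w, I ≤ J w := fun w => ciInf_le hbdd w
  -- Evaluating `J` at the midpoint and applying the parallelogram law: near-minimizers are close
  -- together, so minimizing sequences converge in norm.
  have hmid : ∀ a b, c / 8 * ‖a - b‖ ^ 2 ≤ (J a + J b) / 2 - I := by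
    intro a b
    have h1 := hIle ((1 / 2 : ℝ) • a + (1 / 2 : ℝ) • b)
    have h2 := h.convexOn.2 (mem_univ a) (mem_univ b) (by norm_num : (0 : ℝ) ≤ 1 / 2)
      (by norm_num : (0 : ℝ) ≤ 1 / 2) (by norm_num)
    have h3 := parallelogram_law_with_norm ℝ (a - z) (b - z)
    have h4 : ‖(1 / 2 : ℝ) • a + (1 / 2 : ℝ) • b - z‖ = 1 / 2 * ‖(a - z) + (b - z)‖ := by
      rw [show (1 / 2 : ℝ) • a + (1 / 2 : ℝ) • b - z = (1 / 2 : ℝ) • ((a - z) + (b - z)) by module,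
        norm_smul]
      norm_num
    rw [sub_sub_sub_cancel_right] at h3
    simp only [hJ, smul_eq_mul] at h1 h2 ⊢
    rw [h4] at h1
    nlinarith
  have hex : ∀ n : ℕ, ∃ w, J w < I + 1 / (n + 1) := fun n =>
    exists_lt_of_ciInf_lt (lt_add_of_pos_right I (by positivity))
  choose w hw using hex
  have hcauchy : CauchySeq w := by
    rw [Metric.cauchySeq_iff]
    intro ε hε
    obtain ⟨N, hN⟩ := exists_nat_one_div_lt (show 0 < c / 8 * ε ^ 2 by positivity)
    refine ⟨N, fun a ha b hb => ?_⟩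
    have h1 := hmid (w a) (w b)
    have h2 : (1 : ℝ) / (a + 1) ≤ 1 / (N + 1) := Nat.one_div_le_one_div ha
    have h3 : (1 : ℝ) / (b + 1) ≤ 1 / (N + 1) := Nat.one_div_le_one_div hb
    have h4 : c / 8 * ‖w a - w b‖ ^ 2 < c / 8 * ε ^ 2 := by linarith [hw a, hw b]
    rw [dist_eq_norm]
    exact lt_of_pow_lt_pow_left₀ 2 hε.le (lt_of_mul_lt_mul_left h4 (by positivity))
  obtain ⟨p, hp⟩ := cauchySeq_tendsto_of_complete hcauchy
  refine ⟨p, fun v => ?_⟩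
  have h1 : Tendsto (fun n => J (w n)) atTop (𝓝 (J p)) := (hJc.tendsto p).comp hp
  have h2 : Tendsto (fun n : ℕ => I + 1 / ((n : ℝ) + 1)) atTop (𝓝 (I + 0)) :=
    tendsto_const_nhds.add tendsto_one_div_add_atTop_nhds_zero_nat
  have h3 := le_of_tendsto_of_tendsto' h1 h2 fun n => (hw n).le
  rw [add_zero] at h3
  exact h3.trans (hIle v)

/-- `g` is an admissible velocity at `x` of the gradient flow of `Φ + lam / 2 * ‖· - f‖ ^ 2`. -/
def IsVelocity (Φ : H → ℝ) (lam : ℝ) (f x g : H) : Prop :=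
  IsSubgradient Φ x (-(lam • (x - f) + g))

variable {lam : ℝ} {f : H}

theorem IsVelocity.inner_sub_le {x y a b : H} (hx : IsVelocity Φ lam f x a)
    (hy : IsVelocity Φ lam f y b) : inner ℝ (x - y) (a - b) ≤ -(lam * ‖x - y‖ ^ 2) := by
  have h := IsSubgradient.inner_sub_nonneg hx hy
  rw [show -(lam • (x - f) + a) - -(lam • (y - f) + b) = -(lam • (x - y)) - (a - b) by module,
    inner_sub_left, inner_neg_left, inner_smul_left, real_inner_self_eq_norm_sq,
    real_inner_comm] at h
  simp only [conj_trivial] at h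
  linarith

theorem IsVelocity.norm_le (h : IsLipschitzConvex Φ L) (hlam : 0 < lam) {x g : H}
    (hx : IsVelocity Φ lam f x g) : ‖g‖ ≤ L + lam * ‖x - f‖ := by
  have h1 := IsSubgradient.norm_le h hx
  calc ‖g‖ = ‖-(-(lam • (x - f) + g)) - lam • (x - f)‖ := by congr 1; module
    _ ≤ ‖-(lam • (x - f) + g)‖ + ‖lam • (x - f)‖ := by
      rw [← norm_neg (-(lam • (x - f) + g))]; exact norm_sub_le _ _
    _ ≤ L + lam * ‖x - f‖ := by
      rw [norm_smul, Real.norm_of_nonneg hlam.le]; gcongr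

/-- One step of the implicit Euler scheme. -/
theorem IsLipschitzConvex.exists_euler_step [CompleteSpace H] (h : IsLipschitzConvex Φ L)
    (hlam : 0 < lam) {δ : ℝ} (hδ : 0 < δ) (z : H) :
    ∃ g, IsVelocity Φ lam f (z + δ • g) g := by
  have hc : 0 < δ⁻¹ + lam := by positivity
  -- Completing the square: the penalties `‖p - z‖ ^ 2 / (2 * δ)` and `lam / 2 * ‖p - f‖ ^ 2` merge,
  -- up to a constant, into one centred at the weighted mean of `z` and `f`.
  obtain ⟨p, hp⟩ := h.exists_minimizer hc ((δ⁻¹ + lam)⁻¹ • (δ⁻¹ • z + lam • f))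
  have h1 := isSubgradient_of_forall_le h.convexOn hp
  refine ⟨δ⁻¹ • (p - z), ?_⟩
  rw [smul_inv_smul₀ hδ.ne', add_sub_cancel, IsVelocity]
  convert h1 using 1
  rw [smul_sub (δ⁻¹ + lam), smul_inv_smul₀ hc.ne']
  module

/-- The pull of strength `lam` towards `f` dominates any subgradient once `L ≤ lam * R`, so the ball
of radius `R` around `f` is invariant under the scheme. -/
theorem IsVelocity.norm_euler_sub_le (h : IsLipschitzConvex Φ L) {δ R : ℝ}
    (hlam : 0 < lam) (hδ : 0 < δ) (hR : L ≤ lam * R) {z g : H}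
    (hg : IsVelocity Φ lam f (z + δ • g) g) (hz : ‖z - f‖ ≤ R) : ‖z + δ • g - f‖ ≤ R := by
  have h1 := IsSubgradient.norm_le h hg
  set ξ := -(lam • (z + δ • g - f) + g) with hξ
  have h2 : (1 + δ * lam) • (z + δ • g - f) = (z - f) - δ • ξ := by
    rw [hξ]; module
  have h3 : (1 + δ * lam) * ‖z + δ • g - f‖ ≤ (1 + δ * lam) * R := by
    calc (1 + δ * lam) * ‖z + δ • g - f‖ = ‖(1 + δ * lam) • (z + δ • g - f)‖ := by
          rw [norm_smul, Real.norm_of_nonneg (by positivity)]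
      _ ≤ ‖z - f‖ + ‖δ • ξ‖ := by rw [h2]; exact norm_sub_le _ _
      _ ≤ R + δ * (lam * R) := by
          rw [norm_smul, Real.norm_of_nonneg hδ.le]
          gcongr
          exact h1.trans hR
      _ = (1 + δ * lam) * R := by ring
  exact le_of_mul_le_mul_left h3 (by positivity)

end Subgradient


/-! ### Lipschitz curves as integrals of bounded velocities, and a Gronwall estimate. -/

section Primitive

variable {H : Type*} [NormedAddCommGroup H] [InnerProductSpace ℝ H]

/-- On `[0, b]`, `v` is an integral of the measurable function `g`, which is bounded by `M`. -/
structure IsPrimitive (v g : ℝ → H) (M b : ℝ) : Prop where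
  aestronglyMeasurable : AEStronglyMeasurable g (volume.restrict (Ioo 0 b))
  norm_le : ∀ᵐ r, r ∈ Ioo 0 b → ‖g r‖ ≤ M
  sub_eq : ∀ s ∈ Icc 0 b, ∀ t ∈ Icc 0 b, v t - v s = ∫ r in s..t, g r

variable {v w g k : ℝ → H} {M N b : ℝ}

theorem IsPrimitive.integrableOn (h : IsPrimitive v g M b) : IntegrableOn g (Ioo 0 b) :=
  Integrable.of_bound h.aestronglyMeasurable M
    ((ae_restrict_iff' measurableSet_Ioo).2 h.norm_le)

theorem IsPrimitive.intervalIntegrable (h : IsPrimitive v g M b) {s t : ℝ} (hs : s ∈ Icc 0 b)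
    (ht : t ∈ Icc 0 b) : IntervalIntegrable g volume s t := by
  have hb : (0 : ℝ) ≤ b := hs.1.trans hs.2
  have : IntervalIntegrable g volume 0 b :=
    (intervalIntegrable_iff_integrableOn_Ioo_of_le hb).2 h.integrableOn
  exact this.mono_set (by rw [uIcc_of_le hb]; exact uIcc_subset_Icc hs ht)

theorem IsPrimitive.norm_sub_le (h : IsPrimitive v g M b) {s t : ℝ} (hs : s ∈ Icc 0 b)
    (ht : t ∈ Icc 0 b) : ‖v t - v s‖ ≤ M * |t - s| := by
  rw [h.sub_eq s hs t ht]
  refine intervalIntegral.norm_integral_le_of_norm_le_const_ae ?_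
  -- The integral runs over a half-open interval but the bound on `g` holds on the open one; the
  -- endpoint `b` is discarded as a null set.
  have hb : ∀ᵐ r : ℝ, r ≠ b := by simp [ae_iff, measure_singleton]
  filter_upwards [h.norm_le, hb] with r hr hrb hmem
  have h1 : r ∈ Ioc (min s t) (max s t) := hmem
  exact hr ⟨(le_min hs.1 ht.1).trans_lt h1.1,
    lt_of_le_of_ne (h1.2.trans (max_le hs.2 ht.2)) hrb⟩

theorem IsPrimitive.lipschitzOnWith (h : IsPrimitive v g M b) :
    LipschitzOnWith M.toNNReal v (Icc 0 b) := by
  refine LipschitzOnWith.of_dist_le_mul fun s hs t ht => ?_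
  rw [dist_eq_norm, Real.dist_eq]
  refine (h.norm_sub_le ht hs).trans ?_
  gcongr
  exact Real.le_coe_toNNReal M

theorem IsPrimitive.sub (h : IsPrimitive v g M b) (h' : IsPrimitive w k N b) :
    IsPrimitive (v - w) (g - k) (M + N) b where
  aestronglyMeasurable := h.aestronglyMeasurable.sub h'.aestronglyMeasurable
  norm_le := by
    filter_upwards [h.norm_le, h'.norm_le] with r h1 h2 hr
    exact (_root_.norm_sub_le _ _).trans (add_le_add (h1 hr) (h2 hr))
  sub_eq := fun s hs t ht => by
    simp only [Pi.sub_apply]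
    rw [intervalIntegral.integral_sub (h.intervalIntegrable hs ht) (h'.intervalIntegrable hs ht),
      ← h.sub_eq s hs t ht, ← h'.sub_eq s hs t ht]
    abel

theorem IsPrimitive.mono {b' : ℝ} (h : IsPrimitive v g M b) (hb : b' ≤ b) :
    IsPrimitive v g M b' where
  aestronglyMeasurable := h.aestronglyMeasurable.mono_set (Ioo_subset_Ioo_right hb)
  norm_le := by
    filter_upwards [h.norm_le] with r h1 hr
    exact h1 ⟨hr.1, hr.2.trans_le hb⟩
  sub_eq := fun s hs t ht => h.sub_eq s ⟨hs.1, hs.2.trans hb⟩ t ⟨ht.1, ht.2.trans hb⟩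

theorem isPrimitive_const (x : H) (b : ℝ) : IsPrimitive (fun _ => x) (fun _ => 0) 0 b where
  aestronglyMeasurable := aestronglyMeasurable_const
  norm_le := by simp
  sub_eq := by simp

theorem ae_comp_add_right {p : ℝ → Prop} (s : ℝ) (h : ∀ᵐ r, p r) : ∀ᵐ r, p (r + s) :=
  (measurePreserving_add_right volume s).quasiMeasurePreserving.ae h

theorem IsPrimitive.comp_add_right {s : ℝ} (hs : 0 ≤ s) (h : IsPrimitive v g M (b + s)) :
    IsPrimitive (fun r => v (r + s)) (fun r => g (r + s)) M b where
  aestronglyMeasurable := by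
    have h1 := (measurePreserving_add_right volume s).restrict_preimage
      (measurableSet_Ioo (a := (0 : ℝ) + s) (b := b + s))
    have h2 : AEStronglyMeasurable g (volume.restrict (Ioo (0 + s) (b + s))) :=
      h.aestronglyMeasurable.mono_set (Ioo_subset_Ioo_left (by linarith))
    have h3 := h2.comp_measurePreserving h1
    simpa [Function.comp_def] using h3
  norm_le := by
    filter_upwards [ae_comp_add_right s h.norm_le] with r h1 hr
    exact h1 ⟨by linarith [hr.1], by linarith [hr.2]⟩
  sub_eq := fun r hr t ht => by
    rw [intervalIntegral.integral_comp_add_right (fun r => g r)]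
    exact h.sub_eq _ ⟨by linarith [hr.1], by linarith [hr.2]⟩ _
      ⟨by linarith [ht.1], by linarith [ht.2]⟩

theorem IsPrimitive.ae_hasDerivAt [CompleteSpace H] (h : IsPrimitive v g M b) :
    ∀ᵐ r, r ∈ Ioo 0 b → HasDerivAt v (g r) r := by
  rcases le_or_gt b 0 with hb | hb
  · filter_upwards with r hr using absurd (hr.1.trans hr.2) hb.not_gt
  have h0 : (0 : ℝ) ∈ Icc 0 b := ⟨le_rfl, hb.le⟩
  filter_upwards [(h.intervalIntegrable h0 ⟨hb.le, le_rfl⟩).ae_hasDerivAt_integral] with r h1 hr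
  rw [uIcc_of_le hb.le] at h1
  have h2 := h1 ⟨hr.1.le, hr.2.le⟩ 0 h0
  refine (h2.const_add (v 0)).congr_of_eventuallyEq ?_
  filter_upwards [Ioo_mem_nhds hr.1 hr.2] with t ht
  rw [← h.sub_eq 0 h0 t ⟨ht.1.le, ht.2.le⟩]
  abel

theorem _root_.AbsolutelyContinuousOnInterval.sub_le_mul_of_deriv_le {F F' : ℝ → ℝ} {b C : ℝ}
    (hb : 0 ≤ b) (hF : AbsolutelyContinuousOnInterval F 0 b)
    (hd : ∀ᵐ r, r ∈ Ioo 0 b → HasDerivAt F (F' r) r) (hC : ∀ᵐ r, r ∈ Ioo 0 b → F' r ≤ C) :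
    F b - F 0 ≤ C * b := by
  rw [← hF.integral_deriv_eq_sub]
  have h1 : ∫ r in (0 : ℝ)..b, deriv F r ≤ ∫ r in (0 : ℝ)..b, C := by
    refine intervalIntegral.integral_mono_ae_restrict hb hF.intervalIntegrable_deriv (by simp) ?_
    rw [← restrict_Ioo_eq_restrict_Icc, EventuallyLE, ae_restrict_iff' measurableSet_Ioo]
    filter_upwards [hd, hC] with r h1 h2 hr
    rw [(h1 hr).deriv]
    exact h2 hr
  simpa [mul_comm] using h1

/-- The left side of `hC` is the derivative of `exp (2 * lam * r) * ‖v r‖ ^ 2`. With `C = 0` this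
gives the contraction; with `lam = 0` and small `C`, the comparison of Euler curves. -/
theorem IsPrimitive.exp_mul_norm_sq_le [CompleteSpace H] (h : IsPrimitive v g M b) (hb : 0 ≤ b)
    {lam C : ℝ} (hC : ∀ᵐ r, r ∈ Ioo 0 b →
      Real.exp (2 * lam * r) * (2 * (lam * ‖v r‖ ^ 2 + inner ℝ (v r) (g r))) ≤ C) :
    Real.exp (2 * lam * b) * ‖v b‖ ^ 2 ≤ ‖v 0‖ ^ 2 + C * b := by
  have h1 : AbsolutelyContinuousOnInterval (fun r => ‖v r‖) 0 b := by
    have := (lipschitzWith_one_norm (E := H)).comp_lipschitzOnWith h.lipschitzOnWith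
    rw [← uIcc_of_le hb] at this
    exact this.absolutelyContinuousOnInterval
  have h2 : AbsolutelyContinuousOnInterval (fun r => Real.exp (2 * lam * r)) 0 b :=
    ContDiffOn.absolutelyContinuousOnInterval (by fun_prop)
  have h3 := h2.mul (h1.mul h1)
  have h4 := h3.sub_le_mul_of_deriv_le hb
    (F' := fun r => Real.exp (2 * lam * r) * (2 * (lam * ‖v r‖ ^ 2 + inner ℝ (v r) (g r))))
    (by
      filter_upwards [h.ae_hasDerivAt] with r hr hmem
      have h5 : HasDerivAt (fun r => Real.exp (2 * lam * r))
          (Real.exp (2 * lam * r) * (2 * lam)) r := by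
        simpa using ((hasDerivAt_id r).const_mul (2 * lam)).exp
      have h6 := h5.mul (hr hmem).norm_sq
      refine (h6.congr_deriv (by ring)).congr_of_eventuallyEq (Eventually.of_forall fun t => ?_)
      simp [sq]) hC
  simp only [Pi.mul_apply, mul_zero, Real.exp_zero, one_mul, ← sq, Pi.pow_apply] at h4
  linarith

end Primitive


/-! ### Weak limits along an ultrafilter. -/

section WeakLimit

variable {K : Type*} [NormedAddCommGroup K] [InnerProductSpace ℝ K]

/-- Every bounded sequence in a Hilbert space converges weakly along a given ultrafilter. -/
theorem exists_tendsto_inner_ultrafilter [CompleteSpace K] (U : Ultrafilter ℕ) {x : ℕ → K} {C : ℝ}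
    (hx : ∀ n, ‖x n‖ ≤ C) :
    ∃ y : K, ∀ e, Tendsto (fun n => inner ℝ (x n) e) U (𝓝 (inner ℝ y e)) := by
  have hbound : ∀ e n, inner ℝ (x n) e ∈ Icc (-(C * ‖e‖)) (C * ‖e‖) := fun e n =>
    abs_le.1 ((abs_real_inner_le_norm _ _).trans (by gcongr; exact hx n))
  have hex : ∀ e, ∃ l ∈ Icc (-(C * ‖e‖)) (C * ‖e‖),
      Tendsto (fun n => inner ℝ (x n) e) U (𝓝 l) := by
    -- Along an ultrafilter the bounded scalars converge for every `e` at once, without extracting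
    -- subsequences; the limit is linear and bounded in `e`, and Riesz represents it.
    intro e
    obtain ⟨l, hl, h⟩ := isCompact_Icc.ultrafilter_le_nhds
      (U.map fun n => inner ℝ (x n) e)
      (le_principal_iff.2 (mem_map.2 (Eventually.of_forall (hbound e))))
    exact ⟨l, hl, h⟩
  choose l hl hlim using hex
  let l' : K →ₗ[ℝ] ℝ :=
    { toFun := l
      map_add' := fun a b => tendsto_nhds_unique (hlim (a + b)) (by
        simpa only [inner_add_right] using (hlim a).add (hlim b))
      map_smul' := fun c a => tendsto_nhds_unique (hlim (c • a)) (by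
        simpa only [inner_smul_right, RingHom.id_apply, smul_eq_mul] using (hlim a).const_mul c) }
  let l'' : StrongDual ℝ K := l'.mkContinuous C fun e => abs_le.2 (hl e)
  refine ⟨(InnerProductSpace.toDual ℝ K).symm l'', fun e => ?_⟩
  rw [InnerProductSpace.toDual_symm_apply]
  exact hlim e

variable {α : Type*} [MeasurableSpace α] {μ : Measure α} [IsFiniteMeasure μ]

omit [IsFiniteMeasure μ] in
theorem integrable_inner_of_memLp {g φ : α → K} (hg : MemLp g 2 μ) (hφ : MemLp φ 2 μ) :
    Integrable (fun r => inner ℝ (g r) (φ r)) μ := by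
  refine (L2.integrable_inner (𝕜 := ℝ) (hg.toLp g) (hφ.toLp φ)).congr ?_
  filter_upwards [hg.coeFn_toLp, hφ.coeFn_toLp] with r h1 h2
  rw [h1, h2]

/-- Weak convergence in `L²(μ; K)` along an ultrafilter. -/
def WeakLimit (μ : Measure α) (U : Ultrafilter ℕ) (x : ℕ → α → K) (g : α → K) : Prop :=
  ∀ φ : α → K, MemLp φ 2 μ →
    Tendsto (fun n => ∫ r, inner ℝ (x n r) (φ r) ∂μ) U (𝓝 (∫ r, inner ℝ (g r) (φ r) ∂μ))

theorem exists_weakLimit [CompleteSpace K] (U : Ultrafilter ℕ) {x : ℕ → α → K} {C : ℝ}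
    (hm : ∀ n, AEStronglyMeasurable (x n) μ) (hx : ∀ n r, ‖x n r‖ ≤ C) :
    ∃ g : α → K, MemLp g 2 μ ∧ WeakLimit μ U x g := by
  have hL : ∀ n, MemLp (x n) 2 μ := fun n =>
    MemLp.of_bound (hm n) C (Eventually.of_forall (hx n))
  have hnorm : ∀ n, ‖(hL n).toLp (x n)‖ ≤ μ.real univ ^ ((2 : ℝ≥0∞).toReal⁻¹) * |C| := by
    intro n
    refine Lp.norm_le_of_ae_bound (abs_nonneg C) ?_
    filter_upwards [(hL n).coeFn_toLp] with r hr
    rw [hr]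
    exact (hx n r).trans (le_abs_self C)
  obtain ⟨y, hy⟩ := exists_tendsto_inner_ultrafilter U hnorm
  refine ⟨y, Lp.memLp y, fun φ hφ => ?_⟩
  have h := hy (hφ.toLp φ)
  simp only [L2.inner_def] at h
  convert h using 1
  · funext n
    refine integral_congr_ae ?_
    filter_upwards [(hL n).coeFn_toLp, hφ.coeFn_toLp] with r h1 h2
    rw [h1, h2]
  · congr 1
    refine integral_congr_ae ?_
    filter_upwards [hφ.coeFn_toLp] with r h2
    rw [h2]

/-- Integrated over a measurable set `E`, the inequality is a weak test against `E.indicator φ` and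
passes to the limit; arbitrary `E` recovers the pointwise bound. -/
theorem WeakLimit.ae_inner_le {U : Ultrafilter ℕ} {x : ℕ → α → K} {g : α → K}
    (h : WeakLimit μ U x g) (hU : (U : Filter ℕ) ≤ atTop) (hg : MemLp g 2 μ)
    (hx : ∀ n, MemLp (x n) 2 μ) {φ : α → K} (hφ : MemLp φ 2 μ)
    {F : α → ℝ} (hF : Integrable F μ) {κ : ℕ → ℝ} (hκ : Tendsto κ atTop (𝓝 0))
    (hle : ∀ n, ∀ᵐ r ∂μ, inner ℝ (x n r) (φ r) ≤ F r + κ n) :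
    ∀ᵐ r ∂μ, inner ℝ (g r) (φ r) ≤ F r := by
  refine ae_le_of_forall_setIntegral_le (integrable_inner_of_memLp hg hφ) hF fun E hE _ => ?_
  have hswap : ∀ k : α → K, ∫ r, inner ℝ (k r) (E.indicator φ r) ∂μ
      = ∫ r in E, inner ℝ (k r) (φ r) ∂μ := by
    intro k
    rw [← integral_indicator hE]
    congr 1
    funext r
    by_cases hr : r ∈ E <;> simp [hr]
  have h1 := h (E.indicator φ) (hφ.indicator hE)
  simp only [hswap] at h1
  have h2 : Tendsto (fun n => ∫ r in E, F r ∂μ + κ n * μ.real E) U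
      (𝓝 (∫ r in E, F r ∂μ + 0 * μ.real E)) :=
    tendsto_const_nhds.add ((hκ.mono_left hU).mul_const _)
  rw [zero_mul, add_zero] at h2
  refine le_of_tendsto_of_tendsto' h1 h2 fun n => ?_
  have h3 : ∫ r in E, (F r + κ n) ∂μ = ∫ r in E, F r ∂μ + κ n * μ.real E := by
    rw [integral_add hF.integrableOn (integrable_const _)]
    simp [mul_comm]
  rw [← h3]
  exact setIntegral_mono_ae (integrable_inner_of_memLp (hx n) hφ).integrableOn
    (hF.add (integrable_const _)).integrableOn (hle n)

/-- Expresses a primitive at time `t` as a weak test, so that weak limits of velocities identify the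
limit curve. -/
theorem setIntegral_inner_indicator_Ioo [CompleteSpace K] {g : ℝ → K} {b t : ℝ}
    (hg : IntegrableOn g (Ioo 0 b)) (ht : t ∈ Icc 0 b) (e : K) :
    ∫ r in Ioo 0 b, inner ℝ (g r) ((Ioo 0 t).indicator (fun _ => e) r)
      = inner ℝ (∫ r in (0 : ℝ)..t, g r) e := by
  have h1 : Ioo 0 t ⊆ Ioo 0 b := Ioo_subset_Ioo_right ht.2
  rw [intervalIntegral.integral_of_le ht.1, integral_Ioc_eq_integral_Ioo, real_inner_comm,
    ← integral_inner (hg.mono_set h1)]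
  rw [← inter_eq_self_of_subset_right h1, ← setIntegral_indicator measurableSet_Ioo]
  congr 1
  funext r
  by_cases hr : r ∈ Ioo 0 t
  · simp [hr, inter_eq_self_of_subset_right h1, real_inner_comm]
  · simp [hr, inter_eq_self_of_subset_right h1]

end WeakLimit

/-! ### Interpolated implicit Euler curves. -/

section Euler

variable {H : Type*} [NormedAddCommGroup H] [InnerProductSpace ℝ H] [CompleteSpace H]
variable {Φ : H → ℝ} {L lam : ℝ} {f : H}

theorem integral_floor_div (G : ℕ → H) {δ : ℝ} (hδ : 0 < δ) (n : ℕ) {r : ℝ}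
    (h1 : n * δ ≤ r) (h2 : r ≤ (n + 1) * δ) :
    ∫ t in (n * δ)..r, G ⌊t / δ⌋₊ = (r - n * δ) • G n := by
  rw [← intervalIntegral.integral_const, intervalIntegral.integral_of_le h1,
    intervalIntegral.integral_of_le h1, integral_Ioc_eq_integral_Ioo, integral_Ioc_eq_integral_Ioo]
  refine setIntegral_congr_fun measurableSet_Ioo fun t ht => ?_
  have : ⌊t / δ⌋₊ = n := by
    rw [Nat.floor_eq_iff (div_nonneg ((by positivity : (0 : ℝ) ≤ n * δ).trans ht.1.le) hδ.le),
      le_div_iff₀ hδ, div_lt_iff₀ hδ]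
    exact ⟨ht.1.le, ht.2.trans_le h2⟩
  simp only [this]

omit [InnerProductSpace ℝ H] [CompleteSpace H] in
theorem stronglyMeasurable_floor_div (G : ℕ → H) (δ : ℝ) :
    StronglyMeasurable fun t : ℝ => G ⌊t / δ⌋₊ :=
  (StronglyMeasurable.of_discrete (f := G)).comp_measurable
    (Nat.measurable_floor.comp (measurable_id.div_const δ))

omit [InnerProductSpace ℝ H] [CompleteSpace H] in
theorem intervalIntegrable_of_norm_le {g : ℝ → H} {M : ℝ} (hg : StronglyMeasurable g)
    (hM : ∀ r, ‖g r‖ ≤ M) (a b : ℝ) : IntervalIntegrable g volume a b :=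
  (intervalIntegrable_const (c := M)).mono_fun hg.aestronglyMeasurable
    (Eventually.of_forall fun r => (hM r).trans (le_abs_self M))

/-- The curves produced by the implicit Euler scheme. -/
theorem IsLipschitzConvex.exists_euler_approximation (h : IsLipschitzConvex Φ L)
    (hlam : 0 < lam) (f v₀ : H) :
    ∃ M, ∀ ε > 0, ∃ g P : ℝ → H, StronglyMeasurable g ∧ (∀ r, ‖g r‖ ≤ M) ∧
      (∀ r, IsVelocity Φ lam f (P r) (g r)) ∧
      ∀ r, 0 ≤ r → ‖v₀ + (∫ t in (0 : ℝ)..r, g t) - P r‖ ≤ ε := by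
  -- Large enough to contain the initial datum and to make the ball around `f` invariant.
  set R := max ‖v₀ - f‖ (L / lam) with hR
  have hLR : L ≤ lam * R := by
    rw [← div_le_iff₀' hlam]; exact le_max_right _ _
  have hR0 : 0 ≤ R := (norm_nonneg _).trans (le_max_left _ _)
  have hM0 : 0 ≤ L + lam * R := add_nonneg h.const_nonneg (by positivity)
  refine ⟨L + lam * R, fun ε hε => ?_⟩
  set δ := ε / (L + lam * R + 1) with hδdef
  have hδ : 0 < δ := by positivity
  have hδε : δ * (L + lam * R) ≤ ε := by
    rw [hδdef, div_mul_eq_mul_div, div_le_iff₀ (by positivity)]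
    nlinarith
  choose G hG using fun z => h.exists_euler_step (f := f) hlam hδ z
  let z : ℕ → H := fun n => Nat.rec v₀ (fun _ z => z + δ • G z) n
  have hz : ∀ n, z (n + 1) = z n + δ • G (z n) := fun n => rfl
  have hzR : ∀ n, ‖z n - f‖ ≤ R := by
    intro n
    induction n with
    | zero => exact le_max_left _ _
    | succ n ih => exact (hG (z n)).norm_euler_sub_le h hlam hδ hLR ih
  have hGM : ∀ n, ‖G (z n)‖ ≤ L + lam * R := fun n =>
    ((hG (z n)).norm_le h hlam).trans (by gcongr; exact hzR (n + 1))
  have hmeas := stronglyMeasurable_floor_div (fun n => G (z n)) δ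
  have hint := intervalIntegrable_of_norm_le hmeas fun r => hGM _
  have hnode : ∀ n : ℕ, v₀ + ∫ t in (0 : ℝ)..(n * δ), G (z ⌊t / δ⌋₊) = z n := by
    intro n
    induction n with
    | zero => simp [z]
    | succ n ih =>
      rw [← intervalIntegral.integral_add_adjacent_intervals (hint 0 (n * δ)) (hint _ _),
        ← add_assoc, ih, integral_floor_div (fun n => G (z n)) hδ n (by push_cast; nlinarith)
        (by push_cast; rfl), hz]
      congr 2
      push_cast
      ring
  -- `P` is the node at the end of the current step, since the implicit scheme attains its velocity
  -- there; the curve stays within `δ * (L + lam * R) ≤ ε` of it.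
  refine ⟨fun t => G (z ⌊t / δ⌋₊), fun t => z (⌊t / δ⌋₊ + 1), hmeas, fun r => hGM _,
    fun r => hG _, fun r hr => ?_⟩
  set n := ⌊r / δ⌋₊ with hn
  have h1 : n * δ ≤ r := by
    rw [← le_div_iff₀ hδ]; exact Nat.floor_le (by positivity)
  have h2 : r ≤ (n + 1) * δ := by
    rw [← div_le_iff₀ hδ]; exact (Nat.lt_floor_add_one _).le
  rw [← intervalIntegral.integral_add_adjacent_intervals (hint 0 (n * δ)) (hint _ _),
    ← add_assoc, hnode, integral_floor_div (fun n => G (z n)) hδ n h1 h2]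
  change ‖z n + (r - n * δ) • G (z n) - z (n + 1)‖ ≤ ε
  rw [hz, add_sub_add_left_eq_sub, ← sub_smul, norm_smul]
  refine le_trans ?_ hδε
  refine mul_le_mul ?_ (hGM n) (norm_nonneg _) hδ.le
  rw [Real.norm_eq_abs, abs_le]
  constructor <;> linarith

end Euler


/-! ### Gradient flow: contraction, uniqueness and existence. -/

section Flow

variable {H : Type*} [NormedAddCommGroup H] [InnerProductSpace ℝ H]

/-- `v` is a Lipschitz solution on `[0, b]` of the gradient flow of
`Φ + lam / 2 * ‖· - f‖ ^ 2`. -/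
def IsFlowOn (Φ : H → ℝ) (lam : ℝ) (f : H) (v : ℝ → H) (b : ℝ) : Prop :=
  ∃ (g : ℝ → H) (M : ℝ), IsPrimitive v g M b ∧
    ∀ᵐ r, r ∈ Ioo 0 b → IsVelocity Φ lam f (v r) (g r)

variable {Φ : H → ℝ} {L lam b : ℝ} {f : H} {v w : ℝ → H}

theorem IsFlowOn.mono {b' : ℝ} (h : IsFlowOn Φ lam f v b) (hb : b' ≤ b) :
    IsFlowOn Φ lam f v b' := by
  obtain ⟨g, M, h1, h2⟩ := h
  refine ⟨g, M, h1.mono hb, ?_⟩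
  filter_upwards [h2] with r hr hmem using hr ⟨hmem.1, hmem.2.trans_le hb⟩

theorem IsFlowOn.comp_add_right {s : ℝ} (hs : 0 ≤ s) (h : IsFlowOn Φ lam f v (b + s)) :
    IsFlowOn Φ lam f (fun r => v (r + s)) b := by
  obtain ⟨g, M, h1, h2⟩ := h
  refine ⟨_, M, h1.comp_add_right hs, ?_⟩
  filter_upwards [ae_comp_add_right s h2] with r hr hmem
  exact hr ⟨by linarith [hmem.1], by linarith [hmem.2]⟩

theorem isFlowOn_const {u : H} (hu : IsVelocity Φ lam f u 0) (b : ℝ) :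
    IsFlowOn Φ lam f (fun _ => u) b :=
  ⟨fun _ => 0, 0, isPrimitive_const u b, by simp [hu]⟩

/-- The flow is an exponential contraction. -/
theorem IsFlowOn.norm_sub_le [CompleteSpace H] (hv : IsFlowOn Φ lam f v b)
    (hw : IsFlowOn Φ lam f w b) (hb : 0 ≤ b) :
    ‖v b - w b‖ ≤ ‖v 0 - w 0‖ * Real.exp (-(lam * b)) := by
  obtain ⟨g, M, h1, h2⟩ := hv
  obtain ⟨k, N, h3, h4⟩ := hw
  have h5 := (h1.sub h3).exp_mul_norm_sq_le hb (lam := lam) (C := 0) (by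
    filter_upwards [h2, h4] with r hr1 hr2 hr
    have := (hr1 hr).inner_sub_le (hr2 hr)
    refine mul_nonpos_of_nonneg_of_nonpos (Real.exp_pos _).le ?_
    simp only [Pi.sub_apply]
    linarith)
  simp only [Pi.sub_apply, zero_mul, add_zero] at h5
  rw [show 2 * lam * b = lam * b + lam * b by ring, Real.exp_add, ← sq, ← mul_pow] at h5
  have h6 := le_of_sq_le_sq h5 (norm_nonneg _)
  rw [Real.exp_neg, ← div_eq_mul_inv, le_div_iff₀ (Real.exp_pos _), mul_comm]
  exact h6

theorem IsFlowOn.eq [CompleteSpace H] (hv : IsFlowOn Φ lam f v b)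
    (hw : IsFlowOn Φ lam f w b) (h0 : v 0 = w 0) {t : ℝ} (ht : t ∈ Icc 0 b) : v t = w t := by
  have h := (hv.mono ht.2).norm_sub_le (hw.mono ht.2) ht.1
  rw [h0, sub_self, norm_zero, zero_mul] at h
  exact sub_eq_zero.1 (norm_le_zero_iff.1 h)

theorem IsPrimitive.of_integral {g : ℝ → H} {M : ℝ} (hg : StronglyMeasurable g)
    (hM : ∀ r, ‖g r‖ ≤ M) (v₀ : H) (b : ℝ) :
    IsPrimitive (fun t => v₀ + ∫ r in (0 : ℝ)..t, g r) g M b where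
  aestronglyMeasurable := hg.aestronglyMeasurable
  norm_le := Eventually.of_forall fun r _ => hM r
  sub_eq := fun s _ t _ => by
    have hint := intervalIntegrable_of_norm_le hg hM
    rw [add_sub_add_left_eq_sub, intervalIntegral.integral_interval_sub_left (hint _ _) (hint _ _)]

/-- Transfers the subgradient inequality from `p` to a nearby `x`. The error vanishes with `ρ`, and
the velocity enters only linearly, as the weak limit requires. -/
theorem IsVelocity.inner_le_of_norm_sub_le (h : IsLipschitzConvex Φ L) (hlam : 0 < lam)
    {p g x w : H} {M B ρ : ℝ} (hg : IsVelocity Φ lam f p g) (hgM : ‖g‖ ≤ M)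
    (hρ : ‖p - x‖ ≤ ρ) (hx : ‖x - w‖ ≤ B) (hf : ‖x - f‖ ≤ B) :
    inner ℝ g (x - w) ≤
      Φ w - Φ x - lam * inner ℝ (x - f) (x - w) + ρ * (M + L + lam * (ρ + B + B)) := by
  have h1 := hg w
  have h2 := h.sub_le x p
  have hρ0 : 0 ≤ ρ := (norm_nonneg _).trans hρ
  have hM0 : 0 ≤ M := (norm_nonneg _).trans hgM
  have hB0 : 0 ≤ B := (norm_nonneg _).trans hx
  have h3 : inner ℝ (-(lam • (p - f) + g)) (w - p)
      = lam * inner ℝ (x - f) (x - w) + inner ℝ g (x - w)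
        + inner ℝ g (p - x) + lam * (inner ℝ (p - x) (p - w) + inner ℝ (x - f) (p - x)) := by
    rw [← neg_sub p w, inner_neg_neg, inner_add_left, inner_smul_left]
    simp only [inner_sub_left, inner_sub_right, conj_trivial]
    ring
  have h4 : |inner ℝ g (p - x)| ≤ M * ρ :=
    (abs_real_inner_le_norm _ _).trans (mul_le_mul hgM hρ (norm_nonneg _) hM0)
  have hpw : ‖p - w‖ ≤ ρ + B := by
    rw [← sub_add_sub_cancel p x w]
    exact (norm_add_le _ _).trans (add_le_add hρ hx)
  have h5 : |inner ℝ (p - x) (p - w)| ≤ ρ * (ρ + B) :=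
    (abs_real_inner_le_norm _ _).trans (mul_le_mul hρ hpw (norm_nonneg _) hρ0)
  have h6 : |inner ℝ (x - f) (p - x)| ≤ B * ρ :=
    (abs_real_inner_le_norm _ _).trans (mul_le_mul hf hρ (norm_nonneg _) hB0)
  have h7 : L * ‖x - p‖ ≤ L * ρ := by
    rw [norm_sub_rev]
    exact mul_le_mul_of_nonneg_left hρ h.const_nonneg
  have h8 : -(lam * (ρ * (ρ + B) + B * ρ))
      ≤ lam * (inner ℝ (p - x) (p - w) + inner ℝ (x - f) (p - x)) := by
    rw [← mul_neg]
    refine mul_le_mul_of_nonneg_left ?_ hlam.le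
    linarith [(abs_le.1 h5).1, (abs_le.1 h6).1]
  rw [h3] at h1
  linarith [(abs_le.1 h4).1]

variable [CompleteSpace H]

/-- Monotonicity holds at `P`, `Q`, not on the curves; moving the base points costs `ε + η` against
a velocity difference of at most `2 * M`, and differentiating the square doubles this. -/
theorem norm_sq_sub_le_of_approximations {g k P Q : ℝ → H} {M ε η : ℝ} {v₀ : H}
    (hlam : 0 < lam) (hg : StronglyMeasurable g) (hgM : ∀ r, ‖g r‖ ≤ M)
    (hP : ∀ r, IsVelocity Φ lam f (P r) (g r))
    (hPε : ∀ r, 0 ≤ r → ‖v₀ + (∫ t in (0 : ℝ)..r, g t) - P r‖ ≤ ε)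
    (hk : StronglyMeasurable k) (hkM : ∀ r, ‖k r‖ ≤ M)
    (hQ : ∀ r, IsVelocity Φ lam f (Q r) (k r))
    (hQη : ∀ r, 0 ≤ r → ‖v₀ + (∫ t in (0 : ℝ)..r, k t) - Q r‖ ≤ η) {t : ℝ} (ht : 0 ≤ t) :
    ‖(v₀ + ∫ r in (0 : ℝ)..t, g r) - (v₀ + ∫ r in (0 : ℝ)..t, k r)‖ ^ 2
      ≤ 4 * M * (ε + η) * t := by
  have h := ((IsPrimitive.of_integral hg hgM v₀ t).sub
    (IsPrimitive.of_integral hk hkM v₀ t)).exp_mul_norm_sq_le ht (lam := 0)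
    (C := 4 * M * (ε + η)) (by
      filter_upwards with r hr
      have h1 := (hP r).inner_sub_le (hQ r)
      have h2 := hPε r hr.1.le
      have h3 := hQη r hr.1.le
      set V := v₀ + ∫ t in (0 : ℝ)..r, g t
      set W := v₀ + ∫ t in (0 : ℝ)..r, k t
      have h4 : inner ℝ (V - W) (g r - k r)
          = inner ℝ (P r - Q r) (g r - k r) + inner ℝ ((V - P r) - (W - Q r)) (g r - k r) := by
        rw [← inner_add_left]
        congr 1
        abel
      have h5 : inner ℝ ((V - P r) - (W - Q r)) (g r - k r) ≤ (ε + η) * (M + M) :=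
        (real_inner_le_norm _ _).trans (mul_le_mul
          ((norm_sub_le _ _).trans (add_le_add h2 h3))
          ((norm_sub_le _ _).trans (add_le_add (hgM r) (hkM r))) (norm_nonneg _)
          (add_nonneg ((norm_nonneg _).trans h2) ((norm_nonneg _).trans h3)))
      have h6 : 0 ≤ lam * ‖P r - Q r‖ ^ 2 := by positivity
      simp only [mul_zero, zero_mul, Real.exp_zero, Pi.sub_apply, zero_add, one_mul]
      linarith)
  simpa using h

/-- Existence of the gradient flow. -/
theorem IsLipschitzConvex.exists_isFlowOn [SecondCountableTopology H]
    (h : IsLipschitzConvex Φ L) (hlam : 0 < lam) (f v₀ : H) :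
    ∃ v : ℝ → H, v 0 = v₀ ∧ ∀ b, 0 < b → IsFlowOn Φ lam f v b := by
  obtain ⟨M, hM⟩ := h.exists_euler_approximation hlam f v₀
  have hM' := fun n : ℕ => hM (1 / ((n : ℝ) + 1)) (by positivity)
  choose g P hgm hgM hP hPε using hM'
  have hM0 : 0 ≤ M := (norm_nonneg _).trans (hgM 0 0)
  set ε : ℕ → ℝ := fun n => 1 / ((n : ℝ) + 1) with hε
  have hεlim : Tendsto ε atTop (𝓝 0) := tendsto_one_div_add_atTop_nhds_zero_nat
  have hε0 : ∀ n, 0 < ε n := fun n => by simp only [hε]; positivity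
  set V : ℕ → ℝ → H := fun n t => v₀ + ∫ r in (0 : ℝ)..t, g n r with hV
  have hVV : ∀ n k t, 0 ≤ t → ‖V n t - V k t‖ ^ 2 ≤ 4 * M * (ε n + ε k) * t :=
    fun n k t ht => norm_sq_sub_le_of_approximations hlam (hgm n) (hgM n) (hP n) (hPε n)
      (hgm k) (hgM k) (hP k) (hPε k) ht
  have hcauchy : ∀ t, 0 ≤ t → CauchySeq fun n => V n t := by
    intro t ht
    rw [Metric.cauchySeq_iff]
    intro η hη
    have h1 : Tendsto (fun n => 4 * M * (ε n + ε n) * t) atTop (𝓝 (4 * M * (0 + 0) * t)) :=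
      ((hεlim.add hεlim).const_mul _).mul_const _
    have h2 : ∀ᶠ n in atTop, 4 * M * (ε n + ε n) * t < η ^ 2 :=
      h1.eventually_lt_const (by simp; positivity)
    obtain ⟨n₀, hn₀⟩ := h2.exists
    have hanti : ∀ n, n₀ ≤ n → ε n ≤ ε n₀ := fun n hn => Nat.one_div_le_one_div hn
    refine ⟨n₀, fun m hm n hn => ?_⟩
    rw [dist_eq_norm]
    refine lt_of_pow_lt_pow_left₀ 2 hη.le ((hVV m n t ht).trans_lt (lt_of_le_of_lt ?_ hn₀))
    gcongr
    · exact hanti m hm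
    · exact hanti n hn
  have hlim : ∀ t, ∃ l, 0 ≤ t → Tendsto (fun n => V n t) atTop (𝓝 l) := by
    intro t
    by_cases ht : 0 ≤ t
    · obtain ⟨l, hl⟩ := cauchySeq_tendsto_of_complete (hcauchy t ht)
      exact ⟨l, fun _ => hl⟩
    · exact ⟨0, fun h => absurd h ht⟩
  choose v hv using hlim
  have hVp : ∀ n b, IsPrimitive (V n) (g n) M b := fun n b =>
    IsPrimitive.of_integral (hgm n) (hgM n) v₀ b
  have hv0 : v 0 = v₀ := tendsto_nhds_unique (hv 0 le_rfl) (by simp [hV])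
  have hvlip : ∀ s t, 0 ≤ s → 0 ≤ t → ‖v t - v s‖ ≤ M * |t - s| := fun s t hs ht =>
    le_of_tendsto' ((hv t ht).sub (hv s hs)).norm fun n =>
      (hVp n (max s t)).norm_sub_le ⟨hs, le_max_left _ _⟩ ⟨ht, le_max_right _ _⟩
  have hVv : ∀ n t, 0 ≤ t → ‖V n t - v t‖ ^ 2 ≤ 4 * M * ε n * t := by
    intro n t ht
    have h1 : Tendsto (fun k => 4 * M * (ε n + ε k) * t) atTop (𝓝 (4 * M * (ε n + 0) * t)) :=
      ((tendsto_const_nhds.add hεlim).const_mul _).mul_const _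
    rw [add_zero] at h1
    exact le_of_tendsto_of_tendsto' ((tendsto_const_nhds.sub (hv t ht)).norm.pow 2) h1
      fun k => hVV n k t ht
  refine ⟨v, hv0, fun b hb => ?_⟩
  -- Distance from the limit to the `n`-th curve, plus distance from that curve to its node.
  set ρ : ℕ → ℝ := fun n => √(4 * M * ε n * b) + ε n with hρ
  have hρlim : Tendsto ρ atTop (𝓝 0) := by
    have h1 : Tendsto (fun n => 4 * M * ε n * b) atTop (𝓝 (4 * M * 0 * b)) :=
      (hεlim.const_mul _).mul_const _
    simpa using h1.sqrt.add hεlim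
  have hPv : ∀ n, ∀ r ∈ Ioo 0 b, ‖P n r - v r‖ ≤ ρ n := by
    intro n r hr
    rw [← sub_add_sub_cancel (P n r) (V n r) (v r), add_comm, hρ]
    refine (norm_add_le _ _).trans (add_le_add ?_ ?_)
    · refine Real.le_sqrt_of_sq_le ((hVv n r hr.1.le).trans ?_)
      have := (hε0 n).le
      gcongr
      exact hr.2.le
    · rw [norm_sub_rev]
      exact hPε n r hr.1.le
  have hvb : ∀ x, ∀ r ∈ Ioo 0 b, ‖v r - x‖ ≤ M * b + ‖v₀ - x‖ := by
    intro x r hr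
    rw [← sub_add_sub_cancel (v r) v₀ x]
    refine (norm_add_le _ _).trans (add_le_add_left ?_ _)
    have h1 := hvlip 0 r le_rfl hr.1.le
    rw [hv0, sub_zero, abs_of_pos hr.1] at h1
    exact h1.trans (by gcongr; exact hr.2.le)
  have hvcont : ContinuousOn v (Ioo 0 b) := by
    have : LipschitzOnWith M.toNNReal v (Ioo 0 b) := by
      refine LipschitzOnWith.of_dist_le_mul fun s hs t ht => ?_
      rw [dist_eq_norm, Real.dist_eq, Real.coe_toNNReal M hM0]
      exact hvlip t s ht.1.le hs.1.le
    exact this.continuousOn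
  set μ : Measure ℝ := volume.restrict (Ioo 0 b) with hμ
  have hvm : AEStronglyMeasurable v μ := hvcont.aestronglyMeasurable measurableSet_Ioo
  have hmem : ∀ᵐ r ∂μ, r ∈ Ioo 0 b := ae_restrict_mem measurableSet_Ioo
  set U : Ultrafilter ℕ := hyperfilter ℕ
  have hU : (U : Filter ℕ) ≤ atTop := Nat.hyperfilter_le_atTop
  have hgn : ∀ n, MemLp (g n) 2 μ := fun n =>
    MemLp.of_bound (hgm n).aestronglyMeasurable M (Eventually.of_forall (hgM n))
  obtain ⟨G, hG2, hG⟩ := exists_weakLimit (μ := μ) U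
    (fun n => (hgm n).aestronglyMeasurable) hgM
  have hGi : Integrable G μ := hG2.integrable one_le_two
  have hvG : ∀ t ∈ Icc 0 b, v t - v₀ = ∫ r in (0 : ℝ)..t, G r := by
    intro t ht
    refine ext_inner_right ℝ fun e => ?_
    have h1 := hG ((Ioo 0 t).indicator fun _ => e)
      ((memLp_const e).indicator measurableSet_Ioo)
    have h2 : ∀ n, ∫ r, inner ℝ (g n r) ((Ioo 0 t).indicator (fun _ => e) r) ∂μ
        = inner ℝ (V n t - v₀) e := by
      intro n
      rw [setIntegral_inner_indicator_Ioo ((hgn n).integrable one_le_two) ht e]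
      simp [hV]
    simp only [h2] at h1
    rw [setIntegral_inner_indicator_Ioo hGi ht e] at h1
    exact tendsto_nhds_unique
      ((((hv t ht.1).sub_const v₀).inner tendsto_const_nhds).mono_left hU) h1
  have hvel : ∀ᵐ r ∂μ, IsVelocity Φ lam f (v r) (G r) := by
    have h1 : ∀ w, ∀ᵐ r ∂μ, inner ℝ (G r) (v r - w)
        ≤ Φ w - Φ (v r) - lam * inner ℝ (v r - f) (v r - w) := by
      intro w
      set B := M * b + ‖v₀ - w‖ + ‖v₀ - f‖ with hB
      have hBw : ∀ r ∈ Ioo 0 b, ‖v r - w‖ ≤ B := fun r hr =>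
        (hvb w r hr).trans (le_add_of_nonneg_right (norm_nonneg _))
      have hBf : ∀ r ∈ Ioo 0 b, ‖v r - f‖ ≤ B := fun r hr =>
        (hvb f r hr).trans (by rw [hB]; linarith [norm_nonneg (v₀ - w)])
      have hφ : MemLp (fun r => v r - w) 2 μ :=
        MemLp.of_bound (hvm.sub aestronglyMeasurable_const) B
          (by filter_upwards [hmem] with r hr using hBw r hr)
      have hφf : MemLp (fun r => v r - f) 2 μ :=
        MemLp.of_bound (hvm.sub aestronglyMeasurable_const) B
          (by filter_upwards [hmem] with r hr using hBf r hr)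
      have hΦv : Integrable (fun r => Φ w - Φ (v r)) μ := by
        refine Integrable.of_bound (aestronglyMeasurable_const.sub
          (h.continuous.comp_aestronglyMeasurable hvm)) (L * B) ?_
        filter_upwards [hmem] with r hr
        have h2 := h.sub_le w (v r)
        have h3 := h.sub_le (v r) w
        rw [norm_sub_rev] at h2
        have h4 := mul_le_mul_of_nonneg_left (hBw r hr) h.const_nonneg
        rw [Real.norm_eq_abs, abs_le]
        constructor <;> linarith
      -- For fixed `w`, the inequality along `P n` is tested against `v - w`, with an error `κ n`
      -- tending to zero.
      refine hG.ae_inner_le hU hG2 hgn hφ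
        (hΦv.sub ((integrable_inner_of_memLp hφf hφ).const_mul lam))
        (κ := fun n => ρ n * (M + L + lam * (ρ n + B + B))) ?_ fun n => ?_
      · have := hρlim.mul
          ((((hρlim.add_const B).add_const B).const_mul lam).const_add (M + L))
        simpa using this
      · filter_upwards [hmem] with r hr
        exact (hP n r).inner_le_of_norm_sub_le h hlam (hgM n r) (hPv n r hr) (hBw r hr) (hBf r hr)
    -- The null set depends on `w`: a countable dense family gives a common one, and continuity in
    -- `w` does the rest.
    have h2 : ∀ᵐ r ∂μ, ∀ i, inner ℝ (G r) (v r - TopologicalSpace.denseSeq H i)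
        ≤ Φ (TopologicalSpace.denseSeq H i) - Φ (v r)
          - lam * inner ℝ (v r - f) (v r - TopologicalSpace.denseSeq H i) :=
      ae_all_iff.2 fun i => h1 _
    filter_upwards [h2] with r hr w
    have hcl : IsClosed {w | inner ℝ (G r) (v r - w)
        ≤ Φ w - Φ (v r) - lam * inner ℝ (v r - f) (v r - w)} := by
      have := h.continuous
      exact isClosed_le (by fun_prop) (by fun_prop)
    have h3 : inner ℝ (G r) (v r - w)
        ≤ Φ w - Φ (v r) - lam * inner ℝ (v r - f) (v r - w) :=
      (TopologicalSpace.denseRange_denseSeq H).induction_on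
        (p := fun w => inner ℝ (G r) (v r - w)
          ≤ Φ w - Φ (v r) - lam * inner ℝ (v r - f) (v r - w)) w hcl hr
    rw [← neg_sub (v r) w, inner_neg_neg, inner_add_left, inner_smul_left]
    simp only [conj_trivial]
    linarith
  have hvel' := (ae_restrict_iff' measurableSet_Ioo).1 hvel
  -- The bound on `G` comes from its being a velocity, not from the weak limit.
  refine ⟨G, L + lam * (M * b + ‖v₀ - f‖), ⟨hGi.aestronglyMeasurable, ?_, ?_⟩, hvel'⟩
  · filter_upwards [hvel'] with r hr hrb
    refine ((hr hrb).norm_le h hlam).trans ?_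
    gcongr
    exact hvb f r hrb
  · intro s hs t ht
    have hii : ∀ t ∈ Icc 0 b, IntervalIntegrable G volume 0 t := fun t ht =>
      (intervalIntegrable_iff_integrableOn_Ioo_of_le ht.1).2
        (IntegrableOn.mono_set hGi (Ioo_subset_Ioo_right ht.2))
    rw [← intervalIntegral.integral_interval_sub_left (hii t ht) (hii s hs), ← hvG t ht,
      ← hvG s hs]
    abel

end Flow


theorem IsFlowOn.congr {H : Type*} [NormedAddCommGroup H] [InnerProductSpace ℝ H]
    {Φ : H → ℝ} {lam b : ℝ} {f : H} {v w : ℝ → H} (h : IsFlowOn Φ lam f v b)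
    (hvw : EqOn v w (Icc 0 b)) : IsFlowOn Φ lam f w b := by
  obtain ⟨g, M, h1, h2⟩ := h
  refine ⟨g, M, ⟨h1.aestronglyMeasurable, h1.norm_le, fun s hs t ht => ?_⟩, ?_⟩
  · rw [← hvw hs, ← hvw ht, h1.sub_eq s hs t ht]
  · filter_upwards [h2] with r hr hmem
    rw [← hvw (Ioo_subset_Icc_self hmem)]
    exact hr hmem

/-! ### Total variation as a Lipschitz convex functional; strong solutions as flows. -/

section TotalVariation

variable {X : Type*} [MeasurableSpace X]

/-- On a finite measure space, `L²` embeds continuously into `L¹`. -/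
theorem exists_inclusion_L2_L1 {Y : Type*} [MeasurableSpace Y] (π : Measure Y)
    [IsFiniteMeasure π] : ∃ T : Lp ℝ 2 π →L[ℝ] Lp ℝ 1 π, ∀ u, T u =ᵐ[π] u := by
  have hm : ∀ u : Lp ℝ 2 π, MemLp u 1 π := fun u => (Lp.memLp u).mono_exponent one_le_two
  let T : Lp ℝ 2 π →ₗ[ℝ] Lp ℝ 1 π :=
    { toFun := fun u => (hm u).toLp u
      map_add' := fun u w => by
        rw [← MemLp.toLp_add]
        exact MemLp.toLp_congr _ _ (Lp.coeFn_add u w)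
      map_smul' := fun c u => by
        rw [RingHom.id_apply, ← MemLp.toLp_const_smul]
        exact MemLp.toLp_congr _ _ (Lp.coeFn_smul c u) }
  refine ⟨T.mkContinuous (π univ ^ (1 / (1 : ℝ≥0∞).toReal - 1 / (2 : ℝ≥0∞).toReal)).toReal
    fun u => ?_, fun u => (hm u).coeFn_toLp⟩
  change ‖(hm u).toLp u‖ ≤ _
  rw [Lp.norm_toLp, Lp.norm_def, mul_comm, ← ENNReal.toReal_mul]
  refine ENNReal.toReal_mono (ENNReal.mul_ne_top (Lp.eLpNorm_ne_top u) ?_)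
    (eLpNorm_le_eLpNorm_mul_rpow_measure_univ one_le_two (Lp.aestronglyMeasurable u))
  exact ENNReal.rpow_ne_top_of_nonneg (by norm_num) (measure_ne_top π univ)

variable {m : Kernel X X} [IsMarkovKernel m] {ν : Measure X} [IsFiniteMeasure ν]

/-- The nonlocal gradient `(x, y) ↦ u y - u x` is a bounded operator from `L²(ν)` to
`L¹(ν ⊗ₘ m)`. -/
theorem exists_nonlocalGradient (hinv : Kernel.Invariant m ν) :
    ∃ T : Lp ℝ 2 ν →L[ℝ] Lp ℝ 1 (ν ⊗ₘ m),
      ∀ u, T u =ᵐ[ν ⊗ₘ m] fun p => u p.2 - u p.1 := by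
  -- Both marginals are `ν`, the second by invariance, so composing with either projection is
  -- isometric on `L²`.
  have hfst : MeasurePreserving Prod.fst (ν ⊗ₘ m) ν :=
    ⟨measurable_fst, by rw [← Measure.fst, Measure.fst_compProd]⟩
  have hsnd : MeasurePreserving Prod.snd (ν ⊗ₘ m) ν :=
    ⟨measurable_snd, by rw [← Measure.snd, Measure.snd_compProd, hinv.def]⟩
  obtain ⟨J, hJ⟩ := exists_inclusion_L2_L1 (ν ⊗ₘ m)
  refine ⟨J ∘L ((Lp.compMeasurePreservingₗᵢ ℝ Prod.snd hsnd).toContinuousLinearMap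
    - (Lp.compMeasurePreservingₗᵢ ℝ Prod.fst hfst).toContinuousLinearMap), fun u => ?_⟩
  refine (hJ _).trans ((Lp.coeFn_sub _ _).trans ?_)
  exact (Lp.coeFn_compMeasurePreserving u hsnd).sub (Lp.coeFn_compMeasurePreserving u hfst)

theorem exists_isLipschitzConvex_tvFunctional (hinv : Kernel.Invariant m ν) :
    ∃ (Φ : Lp ℝ 2 ν → ℝ) (L : ℝ), IsLipschitzConvex Φ L ∧
      ∀ u, tvFunctional m ν u = (Φ u : EReal) := by
  obtain ⟨T, hT⟩ := exists_nonlocalGradient hinv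
  refine ⟨fun u => 1 / 2 * ‖T u‖, 1 / 2 * ‖T‖, ⟨⟨convex_univ, fun u _ w _ a b ha hb _ => ?_⟩,
    by positivity, fun u => by positivity, fun u w => ?_⟩, fun u => ?_⟩
  · simp only [map_add, map_smul, smul_eq_mul]
    have h := norm_add_le (a • T u) (b • T w)
    rw [norm_smul, norm_smul, Real.norm_of_nonneg ha, Real.norm_of_nonneg hb] at h
    linarith
  · have h1 := norm_sub_norm_le (T u) (T w)
    have h2 := T.le_opNorm (u - w)
    rw [map_sub] at h2
    linarith
  · have hu : Measurable u := (Lp.stronglyMeasurable u).measurable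
    have h1 : totalVariation m ν u = 2⁻¹ * ‖T u‖ₑ := by
      rw [totalVariation, Lp.enorm_def, eLpNorm_congr_ae (hT u), eLpNorm_one_eq_lintegral_enorm,
        Measure.lintegral_compProd (by fun_prop)]
      simp only [Real.enorm_eq_ofReal_abs]
    have h2 : totalVariation m ν u = ENNReal.ofReal (1 / 2 * ‖T u‖) := by
      rw [h1, ENNReal.ofReal_mul (by norm_num), ofReal_norm]
      congr 1
      rw [one_div, ENNReal.ofReal_inv_of_pos two_pos, ENNReal.ofReal_ofNat]
    rw [tvFunctional, h2, EReal.coe_ennreal_ofReal, max_eq_left (by positivity)]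

variable {Φ : Lp ℝ 2 ν → ℝ} {lam : ℝ} {f : Lp ℝ 2 ν}

omit [IsMarkovKernel m] [IsFiniteMeasure ν] in
theorem mem_oneLaplacian_iff (hΦ : ∀ u, tvFunctional m ν u = (Φ u : EReal)) {x g : Lp ℝ 2 ν} :
    lam • (x - f) + g ∈ oneLaplacian m ν x ↔ IsVelocity Φ lam f x g := by
  simp only [oneLaplacian, subdifferential, mem_ofPred_eq, hΦ, IsVelocity, IsSubgradient]
  norm_cast

omit [IsMarkovKernel m] [IsFiniteMeasure ν] in
theorem isROFMinimizer_iff (hΦ : ∀ u, tvFunctional m ν u = (Φ u : EReal)) {u : Lp ℝ 2 ν} :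
    IsROFMinimizer m ν lam f u ↔
      ∀ w, Φ u + lam / 2 * ‖u - f‖ ^ 2 ≤ Φ w + lam / 2 * ‖w - f‖ ^ 2 := by
  simp only [IsROFMinimizer, rofEnergy, hΦ]
  norm_cast

omit [IsMarkovKernel m] [IsFiniteMeasure ν] in
theorem IsFlowOn.isStrongSolution (hΦ : ∀ u, tvFunctional m ν u = (Φ u : EReal))
    {v : ℝ → Lp ℝ 2 ν} {τ : ℝ} (h : IsFlowOn Φ lam f v τ) :
    IsStrongSolution m ν lam f (v 0) τ v := by
  obtain ⟨g, M, h1, h2⟩ := h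
  refine ⟨h1.lipschitzOnWith.continuousOn, rfl, g, h1.integrableOn.locallyIntegrableOn,
    fun s hs t ht => h1.sub_eq s (Ioo_subset_Icc_self hs) t (Ioo_subset_Icc_self ht), ?_⟩
  filter_upwards [h2] with r hr hmem using (mem_oneLaplacian_iff hΦ).2 (hr hmem)

omit [IsMarkovKernel m] [IsFiniteMeasure ν] in
-- Continuity on the compact `[0, τ]` bounds `v - f`, hence the velocity, which is then integrable
-- up to the endpoints; the integral formula extends there by density of the open interval.
theorem IsStrongSolution.isFlowOn {L : ℝ} (hL : IsLipschitzConvex Φ L) (hlam : 0 < lam)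
    (hΦ : ∀ u, tvFunctional m ν u = (Φ u : EReal))
    {v : ℝ → Lp ℝ 2 ν} {v₀ : Lp ℝ 2 ν} {τ : ℝ} (hτ : 0 < τ)
    (h : IsStrongSolution m ν lam f v₀ τ v) : IsFlowOn Φ lam f v τ := by
  obtain ⟨g, hg, hsub, hmem⟩ := h.exists_deriv
  have hvel : ∀ᵐ r, r ∈ Ioo 0 τ → IsVelocity Φ lam f (v r) (g r) := by
    filter_upwards [hmem] with r hr hr' using (mem_oneLaplacian_iff hΦ).1 (hr hr')
  obtain ⟨B, hB⟩ := isCompact_Icc.exists_bound_of_continuousOn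
    (h.continuousOn.sub (continuousOn_const (c := f)))
  have hbound : ∀ᵐ r, r ∈ Ioo 0 τ → ‖g r‖ ≤ L + lam * B := by
    filter_upwards [hvel] with r hr hr'
    refine ((hr hr').norm_le hL hlam).trans ?_
    gcongr
    exact hB r (Ioo_subset_Icc_self hr')
  have hgm : AEStronglyMeasurable g (volume.restrict (Ioo 0 τ)) := hg.aestronglyMeasurable
  have hgi : IntegrableOn g (Ioo 0 τ) :=
    Integrable.of_bound hgm (L + lam * B) ((ae_restrict_iff' measurableSet_Ioo).2 hbound)
  have hii : ∀ t ∈ Icc 0 τ, IntervalIntegrable g volume 0 t := fun t ht =>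
    (intervalIntegrable_iff_integrableOn_Ioo_of_le ht.1).2
      (hgi.mono_set (Ioo_subset_Ioo_right ht.2))
  have hcont : ContinuousOn (fun t => ∫ r in (0 : ℝ)..t, g r) (Icc 0 τ) := by
    have := intervalIntegral.continuousOn_primitive_interval' (hii τ ⟨hτ.le, le_rfl⟩)
      (left_mem_uIcc)
    rwa [uIcc_of_le hτ.le] at this
  have hhalf : τ / 2 ∈ Ioo 0 τ := ⟨by linarith, by linarith⟩
  have hconst : EqOn (fun t => v t - ∫ r in (0 : ℝ)..t, g r)
      (fun _ => v (τ / 2) - ∫ r in (0 : ℝ)..(τ / 2), g r) (Icc 0 τ) := by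
    refine EqOn.of_subset_closure (s := Ioo 0 τ) (fun t ht => ?_) (h.continuousOn.sub hcont)
      continuousOn_const Ioo_subset_Icc_self (closure_Ioo hτ.ne).ge
    have h1 := hsub _ hhalf t ht
    rw [← intervalIntegral.integral_interval_sub_left (hii t (Ioo_subset_Icc_self ht))
      (hii _ (Ioo_subset_Icc_self hhalf))] at h1
    change v t - _ = v (τ / 2) - _
    rw [sub_eq_sub_iff_sub_eq_sub]
    exact h1
  refine ⟨g, L + lam * B, ⟨hgm, hbound, fun s hs t ht => ?_⟩, hvel⟩
  rw [← intervalIntegral.integral_interval_sub_left (hii t ht) (hii s hs)]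
  have h1 := (hconst ht).trans (hconst hs).symm
  exact sub_eq_sub_iff_sub_eq_sub.1 h1

end TotalVariation

end MRW

/-! ### Minimizer, semigroup and exponential decay. -/

theorem mainTheorem5 {X : Type*} [MetricSpace X] [CompleteSpace X] [SecondCountableTopology X]
    [MeasurableSpace X] [BorelSpace X]
    (m : Kernel X X) [IsMarkovKernel m]
    (hmoment : ∀ z x : X, Integrable (fun y => dist z y) (m x))
    (ν : Measure X) [IsFiniteMeasure ν]
    (hrev : Kernel.IsReversible m ν)
    (herg : MRW.IsErgodic m ((ν univ)⁻¹ • ν))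
    (lam : ℝ) (hlam : 0 < lam) (f : Lp ℝ 2 ν) :
    (∃! u : Lp ℝ 2 ν, MRW.IsROFMinimizer m ν lam f u) ∧
    (∃! T : ℝ≥0 → Lp ℝ 2 ν → Lp ℝ 2 ν, MRW.IsSolutionFamily m ν lam f T) ∧
    ∀ (T : ℝ≥0 → Lp ℝ 2 ν → Lp ℝ 2 ν) (u : Lp ℝ 2 ν),
      MRW.IsSolutionFamily m ν lam f T → MRW.IsROFMinimizer m ν lam f u →
      (∀ v₀ : Lp ℝ 2 ν, T 0 v₀ = v₀) ∧
      (∀ (s t : ℝ≥0) (v₀ : Lp ℝ 2 ν), T (s + t) v₀ = T s (T t v₀)) ∧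
      ∀ (v₀ : Lp ℝ 2 ν) (t : ℝ≥0),
        ‖T t v₀ - u‖ ≤ ‖v₀ - u‖ * Real.exp (-(lam * t)) := by
  obtain ⟨Φ, L, hL, hΦ⟩ := MRW.exists_isLipschitzConvex_tvFunctional hrev.invariant
  have hflow : ∀ T, MRW.IsSolutionFamily m ν lam f T → ∀ v₀ b, 0 < b →
      MRW.IsFlowOn Φ lam f (fun t => T t.toNNReal v₀) b := fun T hT v₀ b hb =>
    (hT v₀ b hb).isFlowOn hL hlam hΦ hb
  have hzero : ∀ T, MRW.IsSolutionFamily m ν lam f T → ∀ v₀, T 0 v₀ = v₀ := fun T hT v₀ => by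
    simpa using (hT v₀ 1 one_pos).initial
  refine ⟨?_, ?_, fun T u hT hu => ⟨hzero T hT, fun s t v₀ => ?_, fun v₀ t => ?_⟩⟩
  · obtain ⟨p, hp⟩ := hL.exists_minimizer hlam f
    refine ⟨p, (MRW.isROFMinimizer_iff hΦ).2 hp, fun u hu => ?_⟩
    have h1 := (MRW.isSubgradient_of_forall_le hL.convexOn hp).add_sq_le u
    have h2 := (MRW.isROFMinimizer_iff hΦ).1 hu p
    have h3 : ‖u - p‖ ^ 2 ≤ 0 := by
      by_contra! hpos
      have := mul_pos (half_pos hlam) hpos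
      linarith
    exact sub_eq_zero.1 (norm_eq_zero.1 (pow_eq_zero_iff two_ne_zero |>.1
      (le_antisymm h3 (sq_nonneg _))))
  -- Finiteness of the exponent lets instance search find that `L²` is second countable, as
  -- existence of the flow requires.
  · have : Fact ((2 : ℝ≥0∞) ≠ ∞) := ⟨ENNReal.ofNat_ne_top⟩
    choose v hv0 hv using fun v₀ => hL.exists_isFlowOn hlam f v₀
    refine ⟨fun t v₀ => v v₀ t, fun v₀ τ hτ => ?_, fun T hT => ?_⟩
    · have h1 : MRW.IsFlowOn Φ lam f (fun t => v v₀ t.toNNReal) τ :=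
        (hv v₀ τ hτ).congr fun t ht => by simp only [Real.coe_toNNReal t ht.1]
      have h2 := h1.isStrongSolution hΦ
      simpa [hv0] using h2
    · funext t v₀
      -- The horizon `t + 1` stays positive when `t = 0`.
      have ht : (0 : ℝ) < t + 1 := by positivity
      have h1 := (hflow T hT v₀ _ ht).eq (hv v₀ _ ht)
        (by simp [hzero T hT, hv0]) (t := t) ⟨t.2, by linarith⟩
      simpa using h1
  · have hb : (0 : ℝ) < s + 1 := by positivity
    have h1 : MRW.IsFlowOn Φ lam f (fun r => T (r + t).toNNReal v₀) (s + 1) :=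
      (hflow T hT v₀ (s + 1 + t) (by positivity)).comp_add_right t.2
    have h2 := h1.eq (hflow T hT (T t v₀) _ hb) (by simp [hzero T hT]) (t := s)
      ⟨s.2, by linarith⟩
    have h3 : ((s : ℝ) + t).toNNReal = s + t := by
      rw [← NNReal.coe_add, Real.toNNReal_coe]
    simpa [h3] using h2
  -- The Euler–Lagrange inclusion of the minimizer says that the velocity `0` is admissible at `u`.
  · have h1 : MRW.IsVelocity Φ lam f u 0 := by
      have := MRW.isSubgradient_of_forall_le hL.convexOn ((MRW.isROFMinimizer_iff hΦ).1 hu)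
      rw [MRW.IsVelocity]
      convert this using 1
      module
    have h2 := ((hflow T hT v₀ (t + 1) (by positivity)).mono (b' := t) (by linarith)).norm_sub_le
      (MRW.isFlowOn_const h1 t) t.2
    simpa [hzero T hT] using h2
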